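/- Conventions. Let $D$ be an integral domain with quotient field $K$. A semistar operation on $D$ is a map $E\mapsto E^\star$ from the set of nonzero $D$-submodules of $K$ to itself such that, for all nonzero $D$-submodules $E,F$ of $K$ and all $0\ne x\in K$: $(xE)^\star=xE^\star$; $E\subseteq F$ implies $E^\star\subseteq F^\star$; $E\subseteq E^\star$ and $(E^\star)^\star=E^\star$. It is a (semi)star operation on $D$ if moreover $D^\star=D$. It is a.b. if, for all nonzero finitely generated $D$-submodules $E$ of $K$ and all nonzero fractional ideals $F,G$ of $D$, $(EF)^\star\subseteq(EG)^\star$ implies $F^\star\subseteq G^\star$. The associated operation of finite type $\star_f$ is $E^{\star_f}=\bigcup\{F^\star : 0\neq F\subseteq E \text{ a finitely generated } D\text{-submodule}\}$. The domain $D$ is a P$\star$MD if $(II^{-1})^{\star_f}=D^{\star_f}$ for every nonzero finitely generated $D$-submodule $I$ of $K$, where $I^{-1}=\{z\in K: zI\subseteq D\}$. Finally, $\mathcal M(\star_f)$ is the set of the maximal elements, under inclusion, of the set of the nonzero proper ideals $I$ of $D$ with $I^{\star_f}\cap D=I$ (these maximal elements are prime ideals). Theorem. Let $D$ be an integral domain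 with quotient field $K$, let $L/K$ be an algebraic field extension, and let $\star$ be a semistar operation on $D$ such that $D$ is a P$\star$MD. Let $T$ be the integral closure of the ring $D^\star$ in $L$, and let $$\mathcal W=\{W : W \text{ is a valuation ring of } L \text{ and } W\cap K=D_Q \text{ for some } Q\in\mathcal M(\star_f)\}.$$ Then $T$ has quotient field $L$ and is contained in every $W\in\mathcal W$. For each nonzero $T$-submodule $E$ of $L$ put $$E^{\overline\star}=\bigcap\{EW : W\in\mathcal W\}$$ (which is $L$ if $\mathcal W=\emptyset$). Then: (1) $\overline\star$ is an a.b. (semi)star operation on $T$; that is, $\overline\star$ is a semistar operation on $T$, it is a.b., and $T^{\overline\star}=T$. (2) $T$ is a P$\overline\star$MD. -/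

import Mathlib

open scoped Pointwise nonZeroDivisors

/-! Throughout, `D` is an integral domain with quotient field `K`, and `D`-submodules of `K`
are elements of `Submodule D K`; here `E * F` is the usual product of submodules,
`1` is (the image of) `D` in `K`, and `1 / E` is `(D :_K E) = {z ∈ K | z E ⊆ D}`. -/

namespace Semistar

section Basic

variable {D K : Type*} [CommRing D] [Field K] [Algebra D K]

/-- A map on `D`-submodules of `K` is a semistar operation if it satisfies the usual axioms on
the nonzero `D`-submodules of `K`. (By `le_star` it maps nonzero submodules to nonzero ones; the
value at `⊥` is irrelevant.) -/
structure IsSemistarOperation (s : Submodule D K → Submodule D K) : Prop where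
  smul_star : ∀ (x : K) (E : Submodule D K), x ≠ 0 → E ≠ ⊥ → s (x • E) = x • s E
  mono : ∀ E F : Submodule D K, E ≠ ⊥ → F ≠ ⊥ → E ≤ F → s E ≤ s F
  le_star : ∀ E : Submodule D K, E ≠ ⊥ → E ≤ s E
  star_star : ∀ E : Submodule D K, E ≠ ⊥ → s (s E) = s E

/-- The condition "a.b." (arithmetisch brauchbar): `(EF)^⋆ ⊆ (EG)^⋆` implies `F^⋆ ⊆ G^⋆`, for
`E` nonzero finitely generated and `F`, `G` nonzero fractional ideals. -/
def IsAB (s : Submodule D K → Submodule D K) : Prop :=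
  ∀ E F G : Submodule D K, E ≠ ⊥ → E.FG → F ≠ ⊥ → IsFractional D⁰ F → G ≠ ⊥ → IsFractional D⁰ G →
    s (E * F) ≤ s (E * G) → s F ≤ s G

/-- The operation of finite type `⋆_f` associated to `⋆`. The supremum is a directed union, see
`mem_finiteType`. -/
def finiteType (s : Submodule D K → Submodule D K) (E : Submodule D K) : Submodule D K :=
  ⨆ F ∈ {F : Submodule D K | F ≠ ⊥ ∧ F.FG ∧ F ≤ E}, s F

/-- `E^{⋆_f}` is the union of the `F^⋆`, for `F ⊆ E` nonzero and finitely generated. -/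
theorem mem_finiteType {s : Submodule D K → Submodule D K} (hs : IsSemistarOperation s)
    {E : Submodule D K} (hE : E ≠ ⊥) (x : K) :
    x ∈ finiteType s E ↔ ∃ F : Submodule D K, (F ≠ ⊥ ∧ F.FG ∧ F ≤ E) ∧ x ∈ s F := by
  have hne : ({F : Submodule D K | F ≠ ⊥ ∧ F.FG ∧ F ≤ E}).Nonempty := by
    obtain ⟨y, hy, hy0⟩ := Submodule.exists_mem_ne_zero_of_ne_bot hE
    exact ⟨Submodule.span D {y}, by simpa using hy0, Submodule.fg_span_singleton y,
      by simpa using hy⟩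
  have hd : DirectedOn (Function.onFun (fun a b => a ≤ b) s)
      {F : Submodule D K | F ≠ ⊥ ∧ F.FG ∧ F ≤ E} := by
    rintro F ⟨hF, hFfg, hFE⟩ G ⟨hG, hGfg, hGE⟩
    have h : F ⊔ G ≠ ⊥ := ne_bot_of_le_ne_bot hF le_sup_left
    exact ⟨F ⊔ G, ⟨h, hFfg.sup hGfg, sup_le hFE hGE⟩, hs.mono _ _ hF h le_sup_left,
      hs.mono _ _ hG h le_sup_right⟩
  have key := Submodule.mem_sSup_of_directed (s := s '' {F | F ≠ ⊥ ∧ F.FG ∧ F ≤ E}) (z := x)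
    (hne.image s) (directedOn_image.2 hd)
  rw [sSup_image] at key
  rw [finiteType, key]
  simp only [Set.exists_mem_image, Set.mem_ofPred_eq]

/-- `I` is `⋆`-invertible: `(I I⁻¹)^⋆ = D^⋆`. -/
def IsInvertible (s : Submodule D K → Submodule D K) (I : Submodule D K) : Prop :=
  s (I * (1 / I)) = s 1

/-- `D` is a P⋆MD (Prüfer `⋆`-multiplication domain): every nonzero finitely generated
`D`-submodule of `K` is `⋆_f`-invertible. -/
def IsPruferMD (s : Submodule D K → Submodule D K) : Prop :=
  ∀ I : Submodule D K, I ≠ ⊥ → I.FG → IsInvertible (finiteType s) I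

/-- `I` is a quasi-`⋆`-ideal: a nonzero ideal of `D` such that `I^⋆ ∩ D = I`. -/
def IsQuasiIdeal (s : Submodule D K → Submodule D K) (I : Ideal D) : Prop :=
  I ≠ ⊥ ∧ (s (IsLocalization.coeSubmodule K I)).comap (Algebra.linearMap D K) = I

/-- `𝓜(⋆)`: the set of quasi-`⋆`-maximal ideals, i.e. the maximal elements of the set of proper
quasi-`⋆`-ideals of `D`. -/
def quasiMaximals (s : Submodule D K → Submodule D K) : Set (Ideal D) :=
  {Q | Maximal (fun I => IsQuasiIdeal s I ∧ I ≠ ⊤) Q}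

variable (K) in
/-- The localization `D_Q` (at a prime `Q`), as a subset of the quotient field `K`. -/
def localizationAt (Q : Ideal D) : Set K :=
  {x | ∃ a b : D, b ∉ Q ∧ x = algebraMap D K a / algebraMap D K b}

/-- The ring `D^⋆`, for a semistar operation `⋆` on `D`. -/
def starRing [IsDomain D] [IsFractionRing D K] {s : Submodule D K → Submodule D K}
    (hs : IsSemistarOperation s) : Subalgebra D K :=
  (s 1).toSubalgebra (hs.le_star 1 one_ne_zero (Submodule.one_le.1 le_rfl)) <| by
    intro x y hx hy
    rcases eq_or_ne x 0 with rfl | hx0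
    · simp
    have h1 : (1 : Submodule D K) ≠ ⊥ := one_ne_zero
    have hx1 : x • (1 : Submodule D K) ≠ ⊥ := fun h => hx0 <| by
      have : x • (1 : K) ∈ x • (1 : Submodule D K) :=
        Submodule.smul_mem_pointwise_smul 1 x 1 (Submodule.one_le.1 le_rfl)
      rw [h] at this
      simpa using this
    have hle : x • (1 : Submodule D K) ≤ s 1 := by
      rintro _ ⟨z, hz, rfl⟩
      obtain ⟨d, rfl⟩ := Submodule.mem_one.1 hz
      have := (s 1).smul_mem d hx
      rwa [Algebra.smul_def, mul_comm] at this
    have hs1 : s 1 ≠ ⊥ := ne_bot_of_le_ne_bot h1 (hs.le_star 1 h1)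
    have h2 := hs.mono _ _ hx1 hs1 hle
    rw [hs.star_star 1 h1, hs.smul_star x 1 hx0 h1] at h2
    exact h2 (Submodule.smul_mem_pointwise_smul y x (s 1) hy)

end Basic

section Extension

variable {D K : Type*} [CommRing D] [IsDomain D] [Field K] [Algebra D K] [IsFractionRing D K]

/-- The integral closure `T` of `D^⋆` in an extension field `L` of `K`. -/
abbrev closureIn {s : Submodule D K → Submodule D K} (hs : IsSemistarOperation s)
    (L : Type*) [Field L] [Algebra K L] : Subalgebra (starRing hs) L :=
  integralClosure (starRing hs) L

/-- The family `𝓦` of the valuation rings `W` of `L` with `W ∩ K = D_Q` for some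
`Q ∈ 𝓜(⋆_f)`. -/
def valuationFamily (s : Submodule D K → Submodule D K) (L : Type*) [Field L] [Algebra K L] :
    Set (ValuationSubring L) :=
  {W | ∃ Q ∈ quasiMaximals (finiteType s), algebraMap K L ⁻¹' (W : Set L) = localizationAt K Q}

/-- The operation `E ↦ ⋂ {EW | W ∈ 𝓦}` on the `T`-submodules of `L`, where `EW` is the
`T`-submodule of `L` generated by the products `e * w`, `e ∈ E`, `w ∈ W`. -/
def extendedOperation {s : Submodule D K → Submodule D K} (hs : IsSemistarOperation s)
    (L : Type*) [Field L] [Algebra K L] (E : Submodule (closureIn hs L) L) :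
    Submodule (closureIn hs L) L :=
  ⨅ W ∈ valuationFamily s L, E * Submodule.span (closureIn hs L) (W : Set L)

end Extension

end Semistar

/-! Let `Q` be quasi-`⋆_f`-maximal. In a P⋆MD no `I I⁻¹` with `I` nonzero finitely generated lies in
`Q`; taking `I = (1, x)` shows that `D_Q` is a valuation ring (`IsPruferMD.exists_valuationSubring`)
and that `D^⋆` is the intersection of these rings (`IsPruferMD.mem_star_one_iff`). An element of `L`
in every `W ∈ 𝓦` is integral over every `D_Q`, so its minimal polynomial over `K` has coefficients
in `D^⋆`; hence `T = ⋂ W` (`mem_closureIn_iff`).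

Any family of valuation rings defines an a.b. semistar operation, because finitely generated modules
become principal over each `W`; it fixes `T` because `T = ⋂ W`.

For the Prüfer property, write a finitely generated `I` as the content `c(f)` of a polynomial over
`L`. As `L/K` is algebraic, `f h = g` for some `h` and some nonzero `g` over `K`. Gauss's lemma in
each `W` gives `c(g) c(g)⁻¹ ⊆ c(f) c(f)⁻¹` (`algebraMap_mem_mul_one_div`). The left side contains a
finitely generated `F` with `1 ∈ F^⋆`; such an `F` lies in no `Q`, so it contains a unit of every
`W`. -/

namespace Semistar

/-! ### Operations of finite type -/

section Basic

variable {D K : Type*} [CommRing D] [Field K] [Algebra D K]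
  {s : Submodule D K → Submodule D K}

theorem smul_ne_bot {x : K} (hx : x ≠ 0) {E : Submodule D K} (hE : E ≠ ⊥) : x • E ≠ ⊥ := by
  obtain ⟨y, hy, hy0⟩ := Submodule.exists_mem_ne_zero_of_ne_bot hE
  intro h
  have := Submodule.smul_mem_pointwise_smul y x E hy
  rw [h, Submodule.mem_bot, smul_eq_mul] at this
  exact mul_ne_zero hx hy0 this

theorem finiteType_mono {E F : Submodule D K} (h : E ≤ F) : finiteType s E ≤ finiteType s F :=
  iSup₂_le fun G hG => le_iSup₂_of_le G ⟨hG.1, hG.2.1, hG.2.2.trans h⟩ le_rfl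

theorem le_finiteType {E F : Submodule D K} (hF : F ≠ ⊥) (hfg : F.FG) (h : F ≤ E) :
    s F ≤ finiteType s E :=
  le_iSup₂_of_le F ⟨hF, hfg, h⟩ le_rfl

theorem finiteType_eq_of_fg (hs : IsSemistarOperation s) {E : Submodule D K} (hE : E ≠ ⊥)
    (hfg : E.FG) : finiteType s E = s E :=
  le_antisymm (iSup₂_le fun F hF => hs.mono F E hF.1 hE hF.2.2) (le_finiteType hE hfg le_rfl)

theorem self_le_finiteType (hs : IsSemistarOperation s) (E : Submodule D K) :
    E ≤ finiteType s E := by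
  intro x hx
  rcases eq_or_ne x 0 with rfl | h0
  · exact zero_mem _
  have hne : Submodule.span D {x} ≠ ⊥ := by simpa using h0
  exact le_finiteType hne (Submodule.fg_span_singleton x) (by simpa using hx)
    (hs.le_star _ hne (Submodule.mem_span_singleton_self x))

theorem smul_finiteType_le (hs : IsSemistarOperation s) {x : K} (hx : x ≠ 0)
    {E : Submodule D K} (hE : E ≠ ⊥) : x • finiteType s E ≤ finiteType s (x • E) := by
  intro y hy
  obtain ⟨z, hz, rfl⟩ := (Submodule.mem_smul_pointwise_iff_exists _ _ _).1 hy
  obtain ⟨F, ⟨hF, hfg, hFE⟩, hzF⟩ := (mem_finiteType hs hE z).1 hz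
  refine le_finiteType (smul_ne_bot hx hF) (hfg.map _) (Set.smul_set_mono hFE) ?_
  rw [hs.smul_star x F hx hF]
  exact Submodule.smul_mem_pointwise_smul z x _ hzF

/-- By directedness one `F` serves all the generators of `G`; this gives the idempotence of `⋆_f`.
-/
theorem exists_fg_le_star_of_le_finiteType (hs : IsSemistarOperation s) {E : Submodule D K}
    (hE : E ≠ ⊥) {G : Submodule D K} (hG : G.FG) (h : G ≤ finiteType s E) :
    ∃ F : Submodule D K, (F ≠ ⊥ ∧ F.FG ∧ F ≤ E) ∧ G ≤ s F := by
  induction G, hG using Submodule.fg_induction with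
  | singleton x =>
    obtain ⟨F, hF, hx⟩ := (mem_finiteType hs hE x).1 (h (Submodule.mem_span_singleton_self x))
    exact ⟨F, hF, by simpa using hx⟩
  | sup G H _ _ ihG ihH =>
    obtain ⟨F, ⟨hF, hfg, hFE⟩, hGF⟩ := ihG (le_sup_left.trans h)
    obtain ⟨F', ⟨hF', hfg', hFE'⟩, hHF⟩ := ihH (le_sup_right.trans h)
    have hne : F ⊔ F' ≠ ⊥ := ne_bot_of_le_ne_bot hF le_sup_left
    exact ⟨F ⊔ F', ⟨hne, hfg.sup hfg', sup_le hFE hFE'⟩,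
      sup_le (hGF.trans (hs.mono _ _ hF hne le_sup_left))
        (hHF.trans (hs.mono _ _ hF' hne le_sup_right))⟩

/-- The operation of finite type associated to a semistar operation is a semistar operation. -/
theorem isSemistarOperation_finiteType (hs : IsSemistarOperation s) :
    IsSemistarOperation (finiteType s) where
  smul_star x E hx hE := by
    refine le_antisymm ?_ (smul_finiteType_le hs hx hE)
    have h := smul_finiteType_le hs (inv_ne_zero hx) (smul_ne_bot hx hE)
    rw [inv_smul_smul₀ hx] at h
    have h' : x • x⁻¹ • finiteType s (x • E) ≤ x • finiteType s E := Set.smul_set_mono h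
    rwa [smul_inv_smul₀ hx] at h'
  mono _ _ _ _ h := finiteType_mono h
  le_star E _ := self_le_finiteType hs E
  star_star E hE := by
    refine le_antisymm (iSup₂_le fun G ⟨hG, hGfg, hGE⟩ => ?_) (self_le_finiteType hs _)
    obtain ⟨F, ⟨hF, hfg, hFE⟩, hGF⟩ := exists_fg_le_star_of_le_finiteType hs hE hGfg hGE
    have h := hs.mono G (s F) hG (ne_bot_of_le_ne_bot hG hGF) hGF
    rw [hs.star_star F hF] at h
    exact h.trans (le_finiteType hF hfg hFE)

theorem finiteType_one (hs : IsSemistarOperation s) : finiteType s 1 = s 1 :=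
  finiteType_eq_of_fg hs one_ne_zero (Submodule.one_eq_span (R := D) (A := K) ▸ Submodule.fg_span_singleton 1)

theorem one_le_star_of_one_mem (hs : IsSemistarOperation s) {E : Submodule D K} (hE : E ≠ ⊥)
    (h : (1 : K) ∈ s E) : s 1 ≤ s E := by
  have h1 : (1 : Submodule D K) ≤ s E := Submodule.one_le.2 h
  have := hs.mono 1 (s E) one_ne_zero (ne_bot_of_le_ne_bot hE (hs.le_star E hE)) h1
  rwa [hs.star_star E hE] at this

end Basic

/-! ### Quasi-maximal ideals and the localizations at them -/

section Maximals

variable {D K : Type*} [CommRing D] [Field K] [Algebra D K] [IsFractionRing D K]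
  {s : Submodule D K → Submodule D K}

open IsLocalization

theorem coeSubmodule_ne_bot {I : Ideal D} (hI : I ≠ ⊥) : coeSubmodule K I ≠ ⊥ :=
  fun h => hI (IsFractionRing.coeSubmodule_injective D K (h.trans (coeSubmodule_bot K).symm))

theorem isQuasiIdeal_of_forall {I : Ideal D} (hs : IsSemistarOperation s) (hI : I ≠ ⊥)
    (h : ∀ d : D, algebraMap D K d ∈ s (coeSubmodule K I) → d ∈ I) : IsQuasiIdeal s I :=
  ⟨hI, le_antisymm h fun d hd => hs.le_star _ (coeSubmodule_ne_bot hI)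
    ((mem_coeSubmodule K I).2 ⟨d, hd, rfl⟩)⟩

omit [IsFractionRing D K] in
theorem IsQuasiIdeal.mem_of_mem {I : Ideal D} (hI : IsQuasiIdeal s I) {d : D}
    (hd : algebraMap D K d ∈ s (coeSubmodule K I)) : d ∈ I := by
  rw [← hI.2]
  exact hd

/-- The quasi-ideal `I^⋆ ∩ D` generated by a nonzero ideal. -/
theorem isQuasiIdeal_comap (hs : IsSemistarOperation s) {I : Ideal D} (hI : I ≠ ⊥) :
    IsQuasiIdeal s ((s (coeSubmodule K I)).comap (Algebra.linearMap D K)) ∧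
      I ≤ (s (coeSubmodule K I)).comap (Algebra.linearMap D K) := by
  have hle : I ≤ (s (coeSubmodule K I)).comap (Algebra.linearMap D K) := fun d hd =>
    hs.le_star _ (coeSubmodule_ne_bot hI) ((mem_coeSubmodule K I).2 ⟨d, hd, rfl⟩)
  have hne := ne_bot_of_le_ne_bot hI hle
  refine ⟨isQuasiIdeal_of_forall hs hne fun d hd => ?_, hle⟩
  have hsI := coeSubmodule_ne_bot (K := K) hI
  have h := hs.mono _ (s (coeSubmodule K I)) (coeSubmodule_ne_bot (K := K) hne)
    (ne_bot_of_le_ne_bot hsI (hs.le_star _ hsI)) <| by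
      intro x hx
      obtain ⟨y, hy, rfl⟩ := (mem_coeSubmodule K _).1 hx
      exact hy
  rw [hs.star_star _ hsI] at h
  exact h hd

/-- Every proper quasi-ideal for an operation of finite type is contained in a quasi-maximal
ideal. -/
theorem exists_le_quasiMaximal (hs : IsSemistarOperation s) {I : Ideal D}
    (hI : IsQuasiIdeal (finiteType s) I) (hI' : I ≠ ⊤) :
    ∃ Q ∈ quasiMaximals (finiteType s), I ≤ Q := by
  suffices h : ∀ c ⊆ {I : Ideal D | IsQuasiIdeal (finiteType s) I ∧ I ≠ ⊤},
      IsChain (· ≤ ·) c → ∀ J ∈ c,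
        ∃ B ∈ {I : Ideal D | IsQuasiIdeal (finiteType s) I ∧ I ≠ ⊤}, ∀ z ∈ c, z ≤ B by
    obtain ⟨Q, hIQ, hQ⟩ := zorn_le_nonempty₀ _ h I ⟨hI, hI'⟩
    exact ⟨Q, hQ, hIQ⟩
  intro c hc hchain J hJ
  have hmem (x : D) : x ∈ sSup c ↔ ∃ J ∈ c, x ∈ J :=
    Submodule.mem_sSup_of_directed ⟨J, hJ⟩ hchain.directedOn
  have hne : sSup c ≠ ⊥ := ne_bot_of_le_ne_bot (hc hJ).1.1 (le_sSup hJ)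
  refine ⟨sSup c, ⟨isQuasiIdeal_of_forall (isSemistarOperation_finiteType hs) hne fun d hd => ?_,
    fun h => ?_⟩, fun z hz => le_sSup hz⟩
  · obtain ⟨F, ⟨hF, hfg, hFc⟩, hdF⟩ := (mem_finiteType hs (coeSubmodule_ne_bot hne) _).1 hd
    have hsup : coeSubmodule K (sSup c) = sSup (coeSubmodule K '' c) := by
      rw [coeSubmodule, sSup_image, sSup_eq_iSup, Submodule.map_iSup]
      simp_rw [Submodule.map_iSup]
      rfl
    have hdir : DirectedOn (· ≤ ·) (coeSubmodule K '' c) := by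
      refine directedOn_image.2 fun A hA B hB => ?_
      obtain ⟨C, hC, h1, h2⟩ := hchain.directedOn A hA B hB
      exact ⟨C, hC, Submodule.map_mono h1, Submodule.map_mono h2⟩
    -- Finite type is essential here: the finitely generated `F` inside the union of the chain
    -- already lies in one member `A`.
    obtain ⟨_, ⟨A, hA, rfl⟩, hFA⟩ := (CompleteLattice.isCompactElement_iff_le_of_directed_sSup_le
      _ F).1 ((Submodule.fg_iff_compact F).1 hfg) (coeSubmodule K '' c)
      (Set.Nonempty.image _ ⟨J, hJ⟩) hdir (hFc.trans hsup.le)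
    exact (hmem d).2 ⟨A, hA, (hc hA).1.mem_of_mem (le_finiteType hF hfg hFA hdF)⟩
  · obtain ⟨A, hA, h1⟩ := (hmem 1).1 (h ▸ Submodule.mem_top)
    exact (hc hA).2 ((Ideal.eq_top_iff_one A).2 h1)

/-- An ideal contained in no quasi-maximal ideal is dense. -/
theorem one_mem_finiteType (hs : IsSemistarOperation s) {J : Ideal D} (hJ : J ≠ ⊥)
    (h : ∀ Q ∈ quasiMaximals (finiteType s), ¬ J ≤ Q) :
    (1 : K) ∈ finiteType s (coeSubmodule K J) := by
  obtain ⟨hq, hle⟩ := isQuasiIdeal_comap (isSemistarOperation_finiteType hs) hJ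
  by_contra h1
  obtain ⟨Q, hQ, hQle⟩ := exists_le_quasiMaximal hs hq fun htop => h1 <| by
    simpa using (Ideal.eq_top_iff_one _).1 htop
  exact h Q hQ (hle.trans hQle)

variable {Q : Ideal D}

omit [IsFractionRing D K] in
theorem maximal_of_mem (hQ : Q ∈ quasiMaximals s) :
    Maximal (fun I => IsQuasiIdeal s I ∧ I ≠ ⊤) Q := by
  simpa [quasiMaximals] using hQ

omit [IsFractionRing D K] in
theorem one_notMem_of_mem_quasiMaximals (hQ : Q ∈ quasiMaximals s) :
    (1 : K) ∉ s (coeSubmodule K Q) := fun h =>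
  (maximal_of_mem hQ).prop.2 ((Ideal.eq_top_iff_one Q).2 ((maximal_of_mem hQ).prop.1.mem_of_mem (by simpa using h)))

/-- If `x ∉ Q`, maximality puts `1` in `(Q + xD)^⋆`. Multiplying by `y` gives `y ∈ (yQ + xyD)^⋆ ⊆
Q^⋆`, hence `y ∈ Q`. -/
theorem isPrime_of_mem_quasiMaximals (hs : IsSemistarOperation s) (hQ : Q ∈ quasiMaximals s) :
    Q.IsPrime := by
  refine ⟨(maximal_of_mem hQ).prop.2, fun {x y} hxy => or_iff_not_imp_left.2 fun hx => ?_⟩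
  have hle : Q ≤ Q ⊔ Ideal.span {x} := le_sup_left
  have hne : Q ⊔ Ideal.span {x} ≠ ⊥ := ne_bot_of_le_ne_bot (maximal_of_mem hQ).prop.1.1 hle
  obtain ⟨hq, hle'⟩ := isQuasiIdeal_comap hs hne
  rcases eq_or_ne y 0 with rfl | hy
  · exact zero_mem _
  have hy' : algebraMap D K y ≠ 0 := by simpa using hy
  have h1 : (1 : K) ∈ s (coeSubmodule K (Q ⊔ Ideal.span {x})) := by
    by_contra h1
    have := (maximal_of_mem hQ).le_of_ge ⟨hq, fun htop => h1 <| by simpa using (Ideal.eq_top_iff_one _).1 htop⟩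
      (hle.trans hle')
    exact hx (this (hle' (Ideal.mem_sup_right (Ideal.mem_span_singleton_self x))))
  refine (maximal_of_mem hQ).prop.1.mem_of_mem ?_
  have h2 := Submodule.smul_mem_pointwise_smul _ (algebraMap D K y) _ h1
  rw [← hs.smul_star _ _ hy' (coeSubmodule_ne_bot hne)] at h2
  have h3 : algebraMap D K y • coeSubmodule K (Q ⊔ Ideal.span {x}) ≤ coeSubmodule K Q := by
    intro z hz
    obtain ⟨w, hw, rfl⟩ := (Submodule.mem_smul_pointwise_iff_exists _ _ _).1 hz
    obtain ⟨d, hd, rfl⟩ := (mem_coeSubmodule K _).1 hw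
    obtain ⟨q, hq, e, he, rfl⟩ := Submodule.mem_sup.1 hd
    obtain ⟨r, rfl⟩ := Ideal.mem_span_singleton.1 he
    refine (mem_coeSubmodule K _).2 ⟨y * (q + x * r), ?_, by simp⟩
    rw [mul_add]
    refine add_mem (Q.mul_mem_left _ hq) ?_
    rw [show y * (x * r) = r * (x * y) by ring]
    exact Q.mul_mem_left _ hxy
  simpa using hs.mono _ _ (smul_ne_bot hy' (coeSubmodule_ne_bot hne))
    (coeSubmodule_ne_bot (maximal_of_mem hQ).prop.1.1) h3 h2

omit [IsFractionRing D K] in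
/-- In a P⋆MD, `I I⁻¹` is contained in no quasi-maximal ideal. -/
theorem IsPruferMD.exists_mul_notMem (hs : IsSemistarOperation s) (hD : IsPruferMD s)
    (hQ : Q ∈ quasiMaximals (finiteType s)) {I : Submodule D K} (hI : I ≠ ⊥) (hfg : I.FG) :
    ∃ z : K, (∀ x ∈ I, ∃ d : D, algebraMap D K d = z * x) ∧
      ∃ x ∈ I, ∃ d ∉ Q, algebraMap D K d = z * x := by
  by_contra! hcon
  have h1 : (1 : K) ∈ finiteType s (I * (1 / I)) := by
    rw [hD I hI hfg]
    exact self_le_finiteType hs 1 (Submodule.one_le.1 le_rfl)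
  refine one_notMem_of_mem_quasiMaximals hQ (finiteType_mono (Submodule.mul_le.2 ?_) h1)
  intro x hx z hz
  have hz' : ∀ x ∈ I, ∃ d : D, algebraMap D K d = z * x := fun x hx =>
    Submodule.mem_one.1 (Submodule.mem_div_iff_forall_mul_mem.1 hz x hx)
  obtain ⟨d, hd⟩ := hz' x hx
  rw [mul_comm]
  exact (mem_coeSubmodule K Q).2 ⟨d, by_contra fun hdQ => hcon z hz' x hx d hdQ hd, hd⟩

/-- In a P⋆MD, the localizations at the quasi-maximal ideals are valuation rings. -/
theorem IsPruferMD.exists_valuationSubring (hs : IsSemistarOperation s) (hD : IsPruferMD s)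
    (hQ : Q ∈ quasiMaximals (finiteType s)) :
    ∃ A : ValuationSubring K, (A : Set K) = localizationAt K Q := by
  have hp := isPrime_of_mem_quasiMaximals (isSemistarOperation_finiteType hs) hQ
  have h0 {b : D} (hb : b ∉ Q) : algebraMap D K b ≠ 0 := fun h =>
    hb (by rw [FaithfulSMul.algebraMap_eq_zero_iff] at h; simp [h])
  refine ⟨⟨{
    carrier := localizationAt K Q
    mul_mem' := ?_
    one_mem' := ⟨1, 1, (Ideal.ne_top_iff_one Q).1 hp.ne_top, by simp⟩
    add_mem' := ?_
    zero_mem' := ⟨0, 1, (Ideal.ne_top_iff_one Q).1 hp.ne_top, by simp⟩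
    neg_mem' := ?_ }, fun x => ?_⟩, rfl⟩
  · rintro _ _ ⟨a, b, hb, rfl⟩ ⟨c, d, hd, rfl⟩
    exact ⟨a * c, b * d, fun h => (hp.mem_or_mem h).elim hb hd, by
      rw [map_mul, map_mul, div_mul_div_comm]⟩
  · rintro _ _ ⟨a, b, hb, rfl⟩ ⟨c, d, hd, rfl⟩
    exact ⟨a * d + b * c, b * d, fun h => (hp.mem_or_mem h).elim hb hd, by
      rw [map_add, map_mul, map_mul, map_mul, div_add_div _ _ (h0 hb) (h0 hd)]⟩
  · rintro _ ⟨a, b, hb, rfl⟩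
    exact ⟨-a, b, hb, by rw [map_neg, neg_div]⟩
  -- For `I = (1, x)` there is `z ∈ I⁻¹` with `zI ⊄ Q`. Thus `a = z` and `b = zx` lie in `D`, not
  -- both in `Q`, and `x = b/a` or `x⁻¹ = a/b` is in `D_Q`.
  · have hI : Submodule.span D {(1 : K), x} ≠ ⊥ := fun h => one_ne_zero (α := K)
      ((Submodule.mem_bot D).1 (h ▸ Submodule.subset_span (by simp)))
    obtain ⟨z, hz, w, hw, d, hdQ, hd⟩ :=
      hD.exists_mul_notMem hs hQ hI (Submodule.fg_span (Set.toFinite _))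
    obtain ⟨a, ha⟩ := hz 1 (Submodule.subset_span (by simp))
    obtain ⟨b, hb⟩ := hz x (Submodule.subset_span (by simp))
    obtain ⟨p, q, rfl⟩ := Submodule.mem_span_pair.1 hw
    have hab : a ∉ Q ∨ b ∉ Q := by
      by_contra! hab
      refine hdQ ?_
      have : d = p * a + q * b := FaithfulSMul.algebraMap_injective D K <| by
        rw [hd, map_add, map_mul, map_mul, ha, hb, Algebra.smul_def, Algebra.smul_def]; ring
      rw [this]
      exact add_mem (Q.mul_mem_left _ hab.1) (Q.mul_mem_left _ hab.2)
    rw [mul_one] at ha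
    refine hab.imp (fun h => ⟨b, a, h, ?_⟩) (fun h => ⟨a, b, h, ?_⟩)
    · rw [eq_div_iff (h0 h), ha, hb, mul_comm]
    · have := h0 h
      rw [eq_div_iff this, ha, hb]
      rw [hb] at this
      field_simp [right_ne_zero_of_mul this]

/-- In a P⋆MD, `D^⋆` is the intersection of the localizations at the quasi-maximal ideals. -/
theorem IsPruferMD.mem_star_one_iff (hs : IsSemistarOperation s) (hD : IsPruferMD s) (x : K) :
    x ∈ s 1 ↔ ∀ Q ∈ quasiMaximals (finiteType s), x ∈ localizationAt K Q := by
  have hf := isSemistarOperation_finiteType hs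
  rw [← finiteType_one hs]
  constructor
  · intro hx Q hQ
    have hI : Submodule.span D {(1 : K), x} ≠ ⊥ := fun h => one_ne_zero (α := K)
      ((Submodule.mem_bot D).1 (h ▸ Submodule.subset_span (by simp)))
    obtain ⟨z, hz, w, hw, d, hdQ, hd⟩ :=
      hD.exists_mul_notMem hs hQ hI (Submodule.fg_span (Set.toFinite _))
    obtain ⟨a, ha⟩ := hz 1 (Submodule.subset_span (by simp))
    obtain ⟨b, hb⟩ := hz x (Submodule.subset_span (by simp))
    obtain ⟨p, q, rfl⟩ := Submodule.mem_span_pair.1 hw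
    rw [mul_one] at ha
    have hz0 : z ≠ 0 := by
      rintro rfl
      rw [zero_mul, FaithfulSMul.algebraMap_eq_zero_iff] at hd
      exact hdQ (hd ▸ zero_mem Q)
    -- If `a = z` were in `Q`, then `b = zx ∈ (zD)^{⋆_f} ⊆ Q^{⋆_f}` would be in `Q` as well, and `zI
    -- ⊆ Q`.
    by_cases haQ : a ∈ Q
    · have hbQ : b ∈ Q := by
        refine (maximal_of_mem hQ).prop.1.mem_of_mem ?_
        have h := Submodule.smul_mem_pointwise_smul _ z _ hx
        rw [← hf.smul_star z 1 hz0 one_ne_zero, smul_eq_mul, ← hb] at h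
        refine finiteType_mono ?_ h
        intro y hy
        obtain ⟨w, hw, rfl⟩ := (Submodule.mem_smul_pointwise_iff_exists _ _ _).1 hy
        obtain ⟨e, rfl⟩ := Submodule.mem_one.1 hw
        exact (mem_coeSubmodule K Q).2 ⟨a * e, Q.mul_mem_right _ haQ, by
          rw [map_mul, ha, smul_eq_mul]⟩
      refine absurd ?_ hdQ
      have : d = p * a + q * b := FaithfulSMul.algebraMap_injective D K <| by
        rw [hd, map_add, map_mul, map_mul, ha, hb, Algebra.smul_def, Algebra.smul_def]; ring
      rw [this]
      exact add_mem (Q.mul_mem_left _ haQ) (Q.mul_mem_left _ hbQ)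
    · exact ⟨b, a, haQ, by rw [ha, hb, mul_div_cancel_left₀ _ hz0]⟩
  · intro hx
    -- `J` is the denominator ideal `(D : x)`. It lies in no `Q`, so `1 ∈ J^{⋆_f}` and `x ∈
    -- (xJ)^{⋆_f} ⊆ D^{⋆_f}`.
    let J : Ideal D := (1 : Submodule D K).comap (LinearMap.toSpanSingleton D K x)
    have hJ (d : D) : d ∈ J ↔ ∃ a : D, algebraMap D K a = d • x := by
      simp [J]
    rcases eq_or_ne x 0 with rfl | hx0
    · exact zero_mem _
    have : Nontrivial D := (algebraMap D K).domain_nontrivial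
    have hJ0 : J ≠ ⊥ := by
      obtain ⟨a, b, hb, rfl⟩ := IsFractionRing.div_surjective (A := D) x
      have hb0 := nonZeroDivisors.ne_zero hb
      refine (Submodule.ne_bot_iff J).2 ⟨b, (hJ b).2 ⟨a, ?_⟩, hb0⟩
      rw [Algebra.smul_def, mul_div_cancel₀]
      simpa using hb0
    have h1 := one_mem_finiteType (K := K) hs hJ0 fun Q hQ hle => by
      obtain ⟨a, b, hb, hxab⟩ := hx Q hQ
      refine hb (hle ((hJ b).2 ⟨a, ?_⟩))
      rw [Algebra.smul_def, hxab, mul_div_cancel₀]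
      rintro h
      rw [FaithfulSMul.algebraMap_eq_zero_iff] at h
      exact hb (h ▸ zero_mem Q)
    have h := Submodule.smul_mem_pointwise_smul _ x _ h1
    rw [← hf.smul_star x _ hx0 (coeSubmodule_ne_bot hJ0), smul_eq_mul, mul_one] at h
    refine finiteType_mono ?_ h
    intro y hy
    obtain ⟨w, hw, rfl⟩ := (Submodule.mem_smul_pointwise_iff_exists _ _ _).1 hy
    obtain ⟨d, hd, rfl⟩ := (mem_coeSubmodule K _).1 hw
    obtain ⟨a, ha⟩ := (hJ d).1 hd
    exact Submodule.mem_one.2 ⟨a, by rw [ha, Algebra.smul_def, smul_eq_mul, mul_comm]⟩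

end Maximals

end Semistar

/-! ### Valuation rings of `L` over a valuation ring of `K` -/

section ExtensionOfValuations

variable {K L : Type*} [Field K] [Field L] [Algebra K L]

open Polynomial Algebra IsLocalRing in
/-- An element which is not integral over a valuation ring `A` of a subfield is missed by some
valuation ring lying over `A`. -/
theorem ValuationSubring.exists_comap_eq_notMem_of_not_isIntegral (A : ValuationSubring K) {x : L}
    (hx : ¬ IsIntegral A.toSubring x) :
    ∃ W : ValuationSubring L, W.comap (algebraMap K L) = A ∧ x ∉ W := by
  have : IsLocalRing A.toSubring := A.isLocalRing
  obtain rfl | hx0 := eq_or_ne x 0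
  · exact (hx isIntegral_zero).elim
  let := invertibleOfNonzero hx0
  let B := A.toSubring[x⁻¹]
  let xinv : B.toSubring := ⟨x⁻¹, subset_adjoin rfl⟩
  -- Otherwise `x` is a root of a polynomial over `A` whose leading coefficient is a unit, hence
  -- integral.
  have : (maximalIdeal A.toSubring).map (algebraMap _ B) + .span {xinv} ≠ ⊤ := fun eq ↦ hx <|
    have ⟨p, hp, hpx⟩ := exists_aeval_invOf_eq_zero_of_idealMap_adjoin_sup_span_eq_top _ _
      (maximalIdeal.isMaximal A.toSubring).ne_top eq
    have H : IsUnit p.leadingCoeff := of_not_not fun h ↦ by simpa using sub_mem h hp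
    ⟨.C H.unit⁻¹.1 * p, by simp [Polynomial.Monic], by
      rw [← aeval_def, map_mul]
      exact mul_eq_zero_of_right _ (by simpa using hpx)⟩
  -- `W` contains `B`, and the proper ideal above consists of nonunits of `W`. Since `x⁻¹` is in it,
  -- `x ∉ W`. Since the maximal ideal of `A` is in it, an element `y ∉ A` has `y⁻¹` a nonunit of
  -- `W`, so `W ∩ K = A`.
  have ⟨W, hBW, hW⟩ := Ideal.image_subset_nonunits_valuationSubring (A := B.toSubring) _ this
  refine ⟨W, ?_, (W.inv_mem_nonunits_iff.mp <|
      hW ⟨_, le_add_self (α := Ideal B) (Ideal.subset_span rfl), rfl⟩).resolve_left hx0⟩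
  ext y
  rw [ValuationSubring.mem_comap]
  refine ⟨fun hy => ?_, fun hy => hBW (B.algebraMap_mem ⟨y, hy⟩)⟩
  by_contra hyA
  have hy0 : y ≠ 0 := fun h => hyA (h ▸ A.zero_mem)
  have hyA' : y⁻¹ ∈ A := (A.mem_or_inv_mem y).resolve_left hyA
  have hym : (⟨y⁻¹, hyA'⟩ : A.toSubring) ∈ maximalIdeal A.toSubring := fun hu => by
    obtain ⟨z, hz⟩ := hu.exists_right_inv
    have hz' : y⁻¹ * z = 1 := congrArg Subtype.val hz
    rw [inv_mul_eq_iff_eq_mul₀ hy0, mul_one] at hz'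
    exact hyA (hz' ▸ z.2)
  have hyW : algebraMap K L y⁻¹ ∈ W.nonunits :=
    hW ⟨_, le_self_add (α := Ideal B) (Ideal.mem_map_of_mem _ hym), rfl⟩
  rw [map_inv₀, W.inv_mem_nonunits_iff] at hyW
  exact hyW.elim (by simpa using hy0) fun h => h hy

/-- The minimal polynomial over `K` of an element that is integral over a valuation ring of `K`
has coefficients in the valuation ring. -/
theorem ValuationSubring.minpoly_coeff_mem (A : ValuationSubring K) {x : L}
    (hx : IsIntegral A.toSubring x) (n : ℕ) : (minpoly K x).coeff n ∈ A := by
  have : IsFractionRing A.toSubring K := inferInstanceAs (IsFractionRing A K)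
  rw [minpoly.isIntegrallyClosed_eq_field_fractions' K hx, Polynomial.coeff_map]
  exact ((minpoly A.toSubring x).coeff n).2

/-- Valuation rings are integrally closed; the integral equation is first moved from `R` to `W`. -/
theorem ValuationSubring.mem_of_isIntegral {R : Type*} [CommRing R] [Algebra R L]
    (W : ValuationSubring L) (hR : ∀ r : R, algebraMap R L r ∈ W) {x : L} (hx : IsIntegral R x) :
    x ∈ W := by
  obtain ⟨p, hp, hpx⟩ := hx
  have hxW : IsIntegral W x := by
    refine ⟨p.map ((algebraMap R L).codRestrict W.toSubring hR), hp.map _, ?_⟩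
    rw [Polynomial.eval₂_map]
    exact hpx
  obtain ⟨y, rfl⟩ := IsIntegrallyClosed.isIntegral_iff.1 hxW
  exact y.2

end ExtensionOfValuations

/-! ### The ring `T` as an intersection of valuation rings, and its quotient field -/

namespace Semistar

variable {D K : Type*} [CommRing D] [IsDomain D] [Field K] [Algebra D K] [IsFractionRing D K]
  {s : Submodule D K → Submodule D K} {L : Type*} [Field L] [Algebra K L]

omit [IsDomain D] [IsFractionRing D K] in
theorem mem_valuationFamily {W : ValuationSubring L} :
    W ∈ valuationFamily s L ↔ ∃ Q ∈ quasiMaximals (finiteType s),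
      ∀ y : K, algebraMap K L y ∈ W ↔ y ∈ localizationAt K Q := by
  simp [valuationFamily, Set.ext_iff]

/-- The integral closure of `D^⋆` in `L` is the intersection of the valuation rings of `L` lying
over the localizations of `D` at the quasi-maximal ideals. -/
theorem mem_closureIn_iff [Algebra.IsAlgebraic K L] (hs : IsSemistarOperation s)
    (hD : IsPruferMD s) (x : L) :
    x ∈ closureIn hs L ↔ ∀ W ∈ valuationFamily s L, x ∈ W := by
  refine ⟨fun hx W hW => W.mem_of_isIntegral (fun r => ?_) hx, fun hx => ?_⟩
  · obtain ⟨Q, hQ, h⟩ := mem_valuationFamily.1 hW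
    exact (h r).2 ((hD.mem_star_one_iff hs _).1 r.2 Q hQ)
  -- Were `x` not integral over some `D_Q`, a member of the family over `D_Q` would miss it.
  have hc (n : ℕ) : (minpoly K x).coeff n ∈ starRing hs := by
    refine (hD.mem_star_one_iff hs _).2 fun Q hQ => ?_
    obtain ⟨A, hA⟩ := hD.exists_valuationSubring hs hQ
    rw [← hA]
    refine A.minpoly_coeff_mem (by_contra fun hxA => ?_) n
    obtain ⟨W, hWA, hxW⟩ := A.exists_comap_eq_notMem_of_not_isIntegral hxA
    refine hxW (hx W (mem_valuationFamily.2 ⟨Q, hQ, fun y => ?_⟩))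
    rw [← hA, ← hWA]
    rfl
  have hl : minpoly K x ∈ Polynomial.lifts (algebraMap (starRing hs) K) :=
    (Polynomial.lifts_iff_coeff_lifts _).2 fun n => ⟨⟨_, hc n⟩, rfl⟩
  have hxK : IsIntegral K x := Algebra.IsIntegral.isIntegral x
  obtain ⟨p, hp, -, hpm⟩ := Polynomial.lifts_and_natDegree_eq_and_monic hl (minpoly.monic hxK)
  refine ⟨p, hpm, ?_⟩
  rw [IsScalarTower.algebraMap_eq (starRing hs) K L, ← Polynomial.eval₂_map, hp]
  exact minpoly.aeval K x

/-- `L` is the quotient field of the integral closure of `D^⋆` in `L`. -/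
theorem isFractionRing_closureIn [Algebra.IsAlgebraic K L] (hs : IsSemistarOperation s) :
    IsFractionRing (closureIn hs L) L := by
  have : Algebra.IsAlgebraic D K := IsFractionRing.comap_isAlgebraic_iff (K := K).2 inferInstance
  have : Algebra.IsAlgebraic (starRing hs) K := Algebra.IsAlgebraic.extendScalars
    (R := D) (FaithfulSMul.algebraMap_injective D (starRing hs))
  have : Algebra.IsAlgebraic (starRing hs) L := Algebra.IsAlgebraic.trans _ K _
  exact integralClosure.isFractionRing_of_algebraic fun x hx =>
    (FaithfulSMul.algebraMap_eq_zero_iff (starRing hs) L).1 hx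

end Semistar

/-! ### The a.b. operation defined by a family of valuation rings -/

namespace Semistar

section ValuationOperation

variable {T L : Type*} [CommRing T] [Field L] [Algebra T L]

/-- The operation `E ↦ ⋂ EW` defined by a family of valuation rings `W`. -/
def valuationOperation (𝒲 : Set (ValuationSubring L)) (E : Submodule T L) : Submodule T L :=
  ⨅ W ∈ 𝒲, E * Submodule.span T (W : Set L)

variable {𝒲 : Set (ValuationSubring L)}

theorem one_le_span_valuationSubring (W : ValuationSubring L) :
    (1 : Submodule T L) ≤ Submodule.span T (W : Set L) :=
  Submodule.one_le.2 (Submodule.subset_span W.one_mem)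

theorem span_valuationSubring_mul_self (W : ValuationSubring L) :
    Submodule.span T (W : Set L) * Submodule.span T (W : Set L) =
      Submodule.span T (W : Set L) := by
  refine le_antisymm ?_ (le_mul_of_one_le_left' (one_le_span_valuationSubring W))
  rw [Submodule.span_mul_span]
  refine Submodule.span_mono ?_
  rintro _ ⟨x, hx, y, hy, rfl⟩
  exact W.mul_mem _ _ hx hy

/-- With `T ⊆ W`, the set `W` is already a `T`-submodule. The semistar axioms and the a.b. property
work with the span alone. -/
theorem mem_span_valuationSubring {W : ValuationSubring L}
    (hW : ∀ t : T, algebraMap T L t ∈ W) {x : L} :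
    x ∈ Submodule.span T (W : Set L) ↔ x ∈ W := by
  refine ⟨fun hx => ?_, fun hx => Submodule.subset_span hx⟩
  induction hx using Submodule.span_induction with
  | mem x hx => exact hx
  | zero => exact W.zero_mem
  | add x y _ _ hx hy => exact W.add_mem _ _ hx hy
  | smul t x _ hx => exact Algebra.smul_def t x ▸ W.mul_mem _ _ (hW t) hx

theorem mem_mul_span_of_valuation_le {E : Submodule T L} {W : ValuationSubring L} {x e : L}
    (he : e ∈ E) (h : W.valuation x ≤ W.valuation e) :
    x ∈ E * Submodule.span T (W : Set L) := by
  obtain ⟨a, rfl⟩ := (W.valuation_le_iff x e).1 h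
  rw [mul_comm (a : L) e]
  exact Submodule.mul_mem_mul he (Submodule.subset_span a.2)

/-- A finitely generated module generates a principal module over a valuation ring. -/
theorem exists_le_span_singleton_mul {E : Submodule T L} (hE : E ≠ ⊥) (hfg : E.FG)
    (W : ValuationSubring L) :
    ∃ e ∈ E, e ≠ 0 ∧ E ≤ Submodule.span T {e} * Submodule.span T (W : Set L) := by
  obtain ⟨S, rfl⟩ := hfg
  have hS : S.Nonempty := Finset.nonempty_iff_ne_empty.2 fun h => hE (by simp [h])
  obtain ⟨e, heS, he⟩ := S.exists_max_image W.valuation hS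
  refine ⟨e, Submodule.subset_span heS, ?_, Submodule.span_le.2 fun x hx =>
    mem_mul_span_of_valuation_le (Submodule.mem_span_singleton_self e) (he x hx)⟩
  rintro rfl
  refine hE (Submodule.span_eq_bot.2 fun x hx => ?_)
  simpa using he x hx

theorem valuationOperation_mono {E F : Submodule T L} (h : E ≤ F) :
    valuationOperation 𝒲 E ≤ valuationOperation 𝒲 F :=
  iInf₂_mono fun _ _ => mul_le_mul_left h _

theorem valuationOperation_le {W : ValuationSubring L} (hW : W ∈ 𝒲) (E : Submodule T L) :
    valuationOperation 𝒲 E ≤ E * Submodule.span T (W : Set L) :=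
  iInf₂_le W hW

theorem le_valuationOperation (E : Submodule T L) : E ≤ valuationOperation 𝒲 E :=
  le_iInf₂ fun W _ => le_mul_of_one_le_right' (one_le_span_valuationSubring W)

/-- Since `WW = W`, the inclusion `E ⊆ FW` already gives `EW ⊆ FW`. Both idempotence and the a.b.
property reduce to this. -/
theorem valuationOperation_le_of_forall {E F : Submodule T L}
    (h : ∀ W ∈ 𝒲, E ≤ F * Submodule.span T (W : Set L)) :
    valuationOperation 𝒲 E ≤ valuationOperation 𝒲 F := by
  refine le_iInf₂ fun W hW => (valuationOperation_le hW E).trans ?_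
  refine (mul_le_mul_left (h W hW) _).trans ?_
  rw [mul_assoc, span_valuationSubring_mul_self]

theorem smul_valuationOperation_le {x : L} (E : Submodule T L) :
    x • valuationOperation 𝒲 E ≤ valuationOperation 𝒲 (x • E) := by
  refine le_iInf₂ fun W hW => ?_
  rw [← Submodule.span_singleton_mul, ← Submodule.span_singleton_mul, mul_assoc]
  exact mul_le_mul_right (valuationOperation_le hW E) _

theorem isSemistarOperation_valuationOperation :
    IsSemistarOperation (valuationOperation (T := T) 𝒲) where
  smul_star x E hx _ := by
    refine le_antisymm ?_ (smul_valuationOperation_le E)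
    have h : x⁻¹ • valuationOperation 𝒲 (x • E) ≤ valuationOperation 𝒲 E := by
      simpa only [inv_smul_smul₀ hx] using smul_valuationOperation_le (x := x⁻¹) (x • E)
    have h' : x • x⁻¹ • valuationOperation 𝒲 (x • E) ≤ x • valuationOperation 𝒲 E :=
      Set.smul_set_mono h
    rwa [smul_inv_smul₀ hx] at h'
  mono _ _ _ _ h := valuationOperation_mono h
  le_star E _ := le_valuationOperation E
  star_star E _ := le_antisymm
    (valuationOperation_le_of_forall fun _ hW => valuationOperation_le hW E)
    (le_valuationOperation _)

/-- Over `W`, the module `E` is generated by a single nonzero `e ∈ E`. So `EF ⊆ EGW` gives `eF ⊆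
eGW`, and `e` cancels. -/
theorem isAB_valuationOperation : IsAB (valuationOperation (T := T) 𝒲) := by
  intro E F G hE hfg _ _ _ _ h
  refine valuationOperation_le_of_forall fun W hW x hx => ?_
  obtain ⟨e, heE, he0, he⟩ := exists_le_span_singleton_mul hE hfg W
  have h1 : e * x ∈ E * G * Submodule.span T (W : Set L) :=
    valuationOperation_le hW _ (h (le_valuationOperation _ (Submodule.mul_mem_mul heE hx)))
  have h2 : E * G * Submodule.span T (W : Set L) ≤
      Submodule.span T {e} * (G * Submodule.span T (W : Set L)) := by
    calc E * G * Submodule.span T (W : Set L)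
        ≤ Submodule.span T {e} * Submodule.span T (W : Set L) * G *
            Submodule.span T (W : Set L) := mul_le_mul_left (mul_le_mul_left he _) _
      _ = Submodule.span T {e} * (G * (Submodule.span T (W : Set L) *
            Submodule.span T (W : Set L))) := by ring
      _ = _ := by rw [span_valuationSubring_mul_self]
  obtain ⟨y, hy, hyx⟩ := Submodule.mem_span_singleton_mul.1 (h2 h1)
  rwa [← mul_left_cancel₀ he0 hyx]

theorem valuationOperation_one
    (hT : ∀ x : L, x ∈ (1 : Submodule T L) ↔ ∀ W ∈ 𝒲, x ∈ W) :
    valuationOperation 𝒲 (1 : Submodule T L) = 1 := by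
  refine le_antisymm (fun x hx => (hT x).2 fun W hW => ?_) (le_valuationOperation 1)
  have h := valuationOperation_le hW 1 hx
  rw [one_mul] at h
  exact (mem_span_valuationSubring fun t => (hT _).1 (Submodule.algebraMap_mem t) W hW).1 h

end ValuationOperation

end Semistar

/-! ### Gauss's lemma for a valuation -/

section Gauss

open Polynomial

variable {L Γ₀ : Type*} [Field L] [LinearOrderedCommGroupWithZero Γ₀]

/-- The first coefficient of maximal value of a polynomial. -/
theorem Valuation.exists_first_max_coeff (v : Valuation L Γ₀) (f : L[X]) :
    ∃ i, (∀ k, v (f.coeff k) ≤ v (f.coeff i)) ∧ ∀ k < i, v (f.coeff k) < v (f.coeff i) := by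
  classical
  have hex : ∃ i, ∀ k, v (f.coeff k) ≤ v (f.coeff i) := by
    rcases eq_or_ne f 0 with rfl | hf
    · exact ⟨0, by simp⟩
    obtain ⟨i, -, hi⟩ := f.support.exists_max_image (fun i => v (f.coeff i))
      (Polynomial.support_nonempty.2 hf)
    refine ⟨i, fun k => ?_⟩
    by_cases hk : k ∈ f.support
    · exact hi k hk
    · simp [Polynomial.notMem_support_iff.1 hk]
  refine ⟨Nat.find hex, Nat.find_spec hex, fun k hk => ?_⟩
  have h := Nat.find_min hex hk
  push Not at h
  obtain ⟨l, hl⟩ := h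
  exact hl.trans_le (Nat.find_spec hex l)

/-- Gauss's lemma: every product of coefficients of `f` and `h` is dominated by a coefficient of
`f * h`. -/
theorem Valuation.exists_coeff_mul_le (v : Valuation L Γ₀) (f h : L[X]) (i j : ℕ) :
    ∃ m, v (f.coeff i) * v (h.coeff j) ≤ v ((f * h).coeff m) := by
  classical
  obtain ⟨i₀, hi, hi'⟩ := v.exists_first_max_coeff f
  obtain ⟨j₀, hj, hj'⟩ := v.exists_first_max_coeff h
  rcases eq_or_ne (v (f.coeff i₀) * v (h.coeff j₀)) 0 with h0 | h0
  · exact ⟨0, (mul_le_mul' (hi i) (hj j)).trans (h0.le.trans zero_le)⟩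
  refine ⟨i₀ + j₀, (mul_le_mul' (hi i) (hj j)).trans_eq ?_⟩
  rw [Polynomial.coeff_mul, ← Finset.add_sum_erase _ _
    (show (i₀, j₀) ∈ Finset.HasAntidiagonal.antidiagonal (i₀ + j₀) by simp)]
  -- Any other pair with sum `i₀ + j₀` has first index below `i₀` or second below `j₀`; as `i₀`,
  -- `j₀` are the first maximal positions, its term is strictly smaller.
  have hlt : v (∑ p ∈ (Finset.HasAntidiagonal.antidiagonal (i₀ + j₀)).erase (i₀, j₀),
      f.coeff p.1 * h.coeff p.2) < v (f.coeff i₀ * h.coeff j₀) := by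
    refine v.map_sum_lt (by rwa [map_mul]) fun p hp => ?_
    obtain ⟨hne, hp⟩ := Finset.mem_erase.1 hp
    rw [Finset.HasAntidiagonal.mem_antidiagonal] at hp
    rw [map_mul, map_mul]
    have hf0 : 0 < v (f.coeff i₀) := zero_lt_iff.2 (left_ne_zero_of_mul h0)
    have hh0 : 0 < v (h.coeff j₀) := zero_lt_iff.2 (right_ne_zero_of_mul h0)
    rcases lt_or_ge p.1 i₀ with hlt | hge
    · exact mul_lt_mul_of_lt_of_le_of_nonneg_of_pos (hi' _ hlt) (hj _) zero_le hh0
    · have hlt : p.2 < j₀ := by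
        rcases hge.eq_or_lt with heq | hgt
        · exact absurd (Prod.ext heq.symm (by omega)) hne
        · omega
      exact (mul_le_mul_left (hi _) _).trans_lt (mul_lt_mul_of_pos_left (hj' _ hlt) hf0)
  rw [v.map_add_eq_of_lt_left hlt, map_mul]

end Gauss

/-! ### Contents of polynomials and the Prüfer property -/

namespace Semistar

open Polynomial

/-- Generators become coefficients so that Gauss's lemma applies; the remaining coefficients are `0`
and do not change the span. -/
theorem exists_polynomial_of_fg {T L : Type*} [CommRing T] [Field L] [Algebra T L]
    {I : Submodule T L} (hfg : I.FG) :
    ∃ f : L[X], I = Submodule.span T (Set.range f.coeff) := by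
  classical
  obtain ⟨n, x, rfl⟩ := Submodule.fg_iff_exists_fin_generating_family.1 hfg
  refine ⟨Polynomial.ofFn n x, le_antisymm (Submodule.span_le.2 ?_) (Submodule.span_le.2 ?_)⟩
  · rintro _ ⟨i, rfl⟩
    exact Submodule.subset_span ⟨i, Polynomial.ofFn_coeff_eq_val_of_lt x i.2⟩
  · rintro _ ⟨i, rfl⟩
    rcases lt_or_ge i n with hi | hi
    · rw [Polynomial.ofFn_coeff_eq_val_of_lt x hi]
      exact Submodule.subset_span ⟨_, rfl⟩
    · rw [Polynomial.ofFn_coeff_eq_zero_of_ge x hi]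
      exact zero_mem _

theorem fg_span_range_coeff {D K : Type*} [CommRing D] [Field K] [Algebra D K] (g : K[X]) :
    (Submodule.span D (Set.range g.coeff)).FG := by
  refine Submodule.fg_span (((g.support.finite_toSet.image g.coeff).insert 0).subset ?_)
  rintro _ ⟨i, rfl⟩
  by_cases hi : g.coeff i = 0
  · exact Or.inl hi
  · exact Or.inr ⟨i, by simpa using hi, rfl⟩

theorem span_range_coeff_ne_bot {D K : Type*} [CommRing D] [Field K] [Algebra D K] {g : K[X]}
    (hg : g ≠ 0) : Submodule.span D (Set.range g.coeff) ≠ ⊥ := by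
  refine fun h => hg (Polynomial.ext fun i => ?_)
  exact Submodule.span_eq_bot.1 h _ ⟨i, rfl⟩

/-- A finitely generated witness makes it enough to test `⋆` instead of `⋆_f`, since `F^⋆ ⊆ (I
I⁻¹)^{⋆_f}`. -/
theorem isPruferMD_of_forall_exists_fg {D K : Type*} [CommRing D] [Field K] [Algebra D K]
    {s : Submodule D K → Submodule D K} (hs : IsSemistarOperation s)
    (h : ∀ I : Submodule D K, I ≠ ⊥ → I.FG →
      ∃ F : Submodule D K, F ≠ ⊥ ∧ F.FG ∧ F ≤ I * (1 / I) ∧ (1 : K) ∈ s F) :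
    IsPruferMD s := by
  intro I hI hfg
  obtain ⟨F, hF, hFfg, hFI, h1⟩ := h I hI hfg
  refine le_antisymm (finiteType_mono Submodule.mul_one_div_le_one) ?_
  rw [finiteType_one hs]
  exact (one_le_star_of_one_mem hs hF h1).trans (le_finiteType hF hFfg hFI)

theorem IsPruferMD.exists_fg_le_mul {D K : Type*} [CommRing D] [Field K] [Algebra D K]
    {s : Submodule D K → Submodule D K} (hs : IsSemistarOperation s) (hD : IsPruferMD s)
    {J : Submodule D K} (hJ : J ≠ ⊥) (hfg : J.FG) :
    ∃ F : Submodule D K, (F ≠ ⊥ ∧ F.FG ∧ F ≤ J * (1 / J)) ∧ (1 : K) ∈ s F := by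
  have h1 : (1 : K) ∈ finiteType s (J * (1 / J)) := by
    rw [hD J hJ hfg]
    exact self_le_finiteType hs 1 (Submodule.one_le.1 le_rfl)
  -- `mem_finiteType` needs a nonzero module; for `⊥` the supremum is empty, which contradicts `h1`.
  refine (mem_finiteType hs (fun hbot => ?_) _).1 h1
  rw [hbot] at h1
  have hb : finiteType s ⊥ = ⊥ := by
    refine le_bot_iff.1 (iSup₂_le fun F hF => ?_)
    exact absurd (le_bot_iff.1 hF.2.2) hF.1
  rw [hb, Submodule.mem_bot] at h1
  exact one_ne_zero h1

variable {D K : Type*} [CommRing D] [IsDomain D] [Field K] [Algebra D K] [IsFractionRing D K]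
  {s : Submodule D K → Submodule D K} {L : Type*} [Field L] [Algebra K L]

omit [IsDomain D] [IsFractionRing D K] in
theorem algebraMap_mem_of_mem_valuationFamily {W : ValuationSubring L}
    (hW : W ∈ valuationFamily s L) {y : K} (hy : y ∈ (1 : Submodule D K)) :
    algebraMap K L y ∈ W := by
  obtain ⟨Q, hQ, h⟩ := mem_valuationFamily.1 hW
  obtain ⟨d, rfl⟩ := Submodule.mem_one.1 hy
  refine (h _).2 ⟨d, 1, fun h1 => (maximal_of_mem hQ).prop.2 ((Ideal.eq_top_iff_one Q).2 h1), ?_⟩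
  rw [map_one, div_one]

omit [IsDomain D] in
/-- A finitely generated `D`-submodule `F` of `D` with `1 ∈ F^⋆` contains, among any generators,
a unit of every `W` in the family. -/
theorem exists_mem_valuation_eq_one {W : ValuationSubring L}
    (hW : W ∈ valuationFamily s L) {S : Set K} (hS : S ⊆ (1 : Submodule D K))
    (hfg : (Submodule.span D S).FG) (hne : Submodule.span D S ≠ ⊥)
    (h1 : (1 : K) ∈ s (Submodule.span D S)) :
    ∃ y ∈ S, W.valuation (algebraMap K L y) = 1 := by
  obtain ⟨Q, hQ, h⟩ := mem_valuationFamily.1 hW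
  -- If all generators were in `Q`, then `1 ∈ Q^{⋆_f}`. A generator outside `Q` is a unit of `D_Q =
  -- W ∩ K`.
  have hle : ¬ S ⊆ IsLocalization.coeSubmodule K Q := fun hle =>
    one_notMem_of_mem_quasiMaximals hQ (le_finiteType hne hfg (Submodule.span_le.2 hle) h1)
  obtain ⟨y, hyS, hyQ⟩ := Set.not_subset.1 hle
  refine ⟨y, hyS, le_antisymm
    ((W.valuation_le_one_iff _).2 (algebraMap_mem_of_mem_valuationFamily hW (hS hyS))) ?_⟩
  obtain ⟨d, rfl⟩ := Submodule.mem_one.1 (hS hyS)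
  have hd : d ∉ Q := fun hd => hyQ ((IsLocalization.mem_coeSubmodule K Q).2 ⟨d, hd, rfl⟩)
  have hd0 : algebraMap K L (algebraMap D K d) ≠ 0 := by
    rw [_root_.map_ne_zero]
    exact fun h0 => hd ((FaithfulSMul.algebraMap_eq_zero_iff D K).1 h0 ▸ zero_mem Q)
  have hinv : (algebraMap K L (algebraMap D K d))⁻¹ ∈ W := by
    rw [← map_inv₀]
    exact (h _).2 ⟨1, d, hd, by rw [map_one, one_div]⟩
  have := (W.valuation_le_one_iff _).2 hinv
  rw [map_inv₀] at this
  exact (inv_le_one₀ (zero_lt_iff.2 ((Valuation.ne_zero_iff _).2 hd0))).1 this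

variable {T : Type*} [CommRing T] [Algebra T L]

omit [IsDomain D] [IsFractionRing D K] in
/-- If `f * h` is a polynomial `g` over `K`, then `c(g) c(g)⁻¹` is contained in `c(f) c(f)⁻¹`. -/
theorem algebraMap_mem_mul_one_div
    (hT : ∀ x : L, x ∈ (1 : Submodule T L) ↔ ∀ W ∈ valuationFamily s L, x ∈ W)
    {f h : L[X]} {g : K[X]} (hg : g.map (algebraMap K L) = f * h) {y : K}
    (hy : y ∈ Submodule.span D (Set.range g.coeff) *
      (1 / Submodule.span D (Set.range g.coeff))) :
    algebraMap K L y ∈ Submodule.span T (Set.range f.coeff) *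
      (1 / Submodule.span T (Set.range f.coeff)) := by
  -- By Gauss's lemma `v(f_i h_j z) ≤ v(g_m z) ≤ 1` for some `m` depending on `W`; as `T = ⋂ W`,
  -- this puts `f_i h_j z` in `T`.
  have hinv {z : K} (hz : z ∈ 1 / Submodule.span D (Set.range g.coeff)) (j : ℕ) :
      h.coeff j * algebraMap K L z ∈ 1 / Submodule.span T (Set.range f.coeff) := by
    refine Submodule.mem_div_iff_forall_mul_mem.2 fun x hx => ?_
    induction hx using Submodule.span_induction with
    | zero => rw [mul_zero]; exact zero_mem _
    | add x y _ _ hx hy => rw [mul_add]; exact add_mem hx hy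
    | smul t x _ hx => rw [mul_smul_comm]; exact Submodule.smul_mem _ t hx
    | mem x hx =>
      obtain ⟨i, rfl⟩ := hx
      refine (hT _).2 fun W hW => ?_
      obtain ⟨m, hm⟩ := W.valuation.exists_coeff_mul_le f h i j
      rw [← hg, Polynomial.coeff_map] at hm
      have hzm := algebraMap_mem_of_mem_valuationFamily (D := D) hW
        (Submodule.mem_div_iff_forall_mul_mem.1 hz _ (Submodule.subset_span ⟨m, rfl⟩))
      rw [← W.valuation_le_one_iff] at hzm ⊢
      rw [map_mul, map_mul] at hzm
      rw [map_mul, map_mul, mul_comm, ← mul_assoc]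
      refine le_trans ?_ hzm
      rw [mul_comm (W.valuation (algebraMap K L z))]
      exact mul_le_mul_left hm _
  refine Submodule.mul_induction_on hy (fun x hx z hz => ?_) fun x y hx hy => ?_
  · induction hx using Submodule.span_induction generalizing z with
    | zero => rw [zero_mul, map_zero]; exact zero_mem _
    | add x y _ _ hx hy => rw [add_mul, map_add]; exact add_mem (hx z hz) (hy z hz)
    | smul d x _ hx =>
      rw [smul_mul_assoc, ← mul_smul_comm]
      exact hx _ (Submodule.smul_mem _ d hz)
    | mem x hx =>
      obtain ⟨m, rfl⟩ := hx
      -- `g_m z` is the sum of the `f_i (h_j z)` over `i + j = m`, with each `h_j z` in `c(f)⁻¹`.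
      rw [map_mul, ← Polynomial.coeff_map, hg, Polynomial.coeff_mul, Finset.sum_mul]
      refine sum_mem fun p _ => ?_
      rw [mul_assoc]
      exact Submodule.mul_mem_mul (Submodule.subset_span ⟨_, rfl⟩) (hinv hz _)
  · rw [map_add]
    exact add_mem hx hy

omit [IsDomain D] in
/-- The operation defined by the valuation rings lying over the localizations of a P⋆MD at the
quasi-maximal ideals turns their intersection into a Prüfer multiplication domain. -/
theorem isPruferMD_valuationOperation [Algebra.IsAlgebraic K L] (hs : IsSemistarOperation s)
    (hD : IsPruferMD s)
    (hT : ∀ x : L, x ∈ (1 : Submodule T L) ↔ ∀ W ∈ valuationFamily s L, x ∈ W) :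
    IsPruferMD (valuationOperation (T := T) (valuationFamily s L)) := by
  refine isPruferMD_of_forall_exists_fg isSemistarOperation_valuationOperation fun I hI hfg => ?_
  obtain ⟨f, rfl⟩ := exists_polynomial_of_fg hfg
  have hf : f ≠ 0 := by
    rintro rfl
    exact hI (Submodule.span_eq_bot.2 (by rintro _ ⟨i, rfl⟩; simp))
  -- Algebraicity of `L/K` enters here: `f` has a nonzero multiple with coefficients in `K`.
  obtain ⟨g, hg0, h, hg⟩ := Polynomial.exists_dvd_map_of_isAlgebraic (R := K) hf
  obtain ⟨F, ⟨hF, hFfg, hFle⟩, h1⟩ :=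
    hD.exists_fg_le_mul hs (span_range_coeff_ne_bot hg0) (fg_span_range_coeff g)
  obtain ⟨S, rfl⟩ := hFfg
  have hS : (S : Set K) ⊆ (1 : Submodule D K) := fun y hy =>
    Submodule.mul_one_div_le_one (hFle (Submodule.subset_span hy))
  refine ⟨Submodule.span T (algebraMap K L '' S), ?_,
    Submodule.fg_span (S.finite_toSet.image _), Submodule.span_le.2 ?_, ?_⟩
  · intro hbot
    refine hF (Submodule.span_eq_bot.2 fun y hy => ?_)
    simpa using Submodule.span_eq_bot.1 hbot _ ⟨y, hy, rfl⟩
  · rintro _ ⟨y, hy, rfl⟩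
    exact algebraMap_mem_mul_one_div hT hg (hFle (Submodule.subset_span hy))
  · simp only [valuationOperation, Submodule.mem_iInf]
    intro W hW
    -- The unit `y` varies with `W`, but `F` does not; `y ∈ F` gives `1 ∈ FW`.
    obtain ⟨y, hy, hyW⟩ :=
      exists_mem_valuation_eq_one hW hS (Submodule.fg_span S.finite_toSet) hF h1
    exact mem_mul_span_of_valuation_le (Submodule.subset_span ⟨y, hy, rfl⟩)
      ((map_one W.valuation).trans hyW.symm).le

end Semistar

theorem mainTheorem3 {D K L : Type*} [CommRing D] [IsDomain D] [Field K] [Algebra D K]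
    [IsFractionRing D K] [Field L] [Algebra K L] [Algebra.IsAlgebraic K L]
    (s : Submodule D K → Submodule D K) (hs : Semistar.IsSemistarOperation s)
    (hD : Semistar.IsPruferMD s) :
    IsFractionRing (Semistar.closureIn hs L) L ∧
    (∀ W ∈ Semistar.valuationFamily s L, (Semistar.closureIn hs L : Set L) ⊆ (W : Set L)) ∧
    Semistar.IsSemistarOperation (Semistar.extendedOperation hs L) ∧
    Semistar.extendedOperation hs L 1 = 1 ∧
    Semistar.IsAB (Semistar.extendedOperation hs L) ∧
    Semistar.IsPruferMD (Semistar.extendedOperation hs L) := by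
  have hT (x : L) : x ∈ (1 : Submodule (Semistar.closureIn hs L) L) ↔
      ∀ W ∈ Semistar.valuationFamily s L, x ∈ W := by
    rw [← Semistar.mem_closureIn_iff hs hD, Submodule.mem_one]
    exact ⟨fun ⟨y, hy⟩ => hy ▸ y.2, fun hx => ⟨⟨x, hx⟩, rfl⟩⟩
  -- `extendedOperation` unfolds to `valuationOperation` of the family over `T`, so the general
  -- results apply as they stand.
  exact ⟨Semistar.isFractionRing_closureIn hs,
    fun W hW x hx => (Semistar.mem_closureIn_iff hs hD x).1 hx W hW,
    Semistar.isSemistarOperation_valuationOperation, Semistar.valuationOperation_one hT,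
    Semistar.isAB_valuationOperation, Semistar.isPruferMD_valuationOperation hs hD hT⟩
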